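/- Let $k$ be a field. Dg modules over $k$ are $\mathbb Z$-graded with differential of degree $-1$, and the Koszul sign rule is used throughout. **Box operads.** A box of colour $(p,q,r)\in\mathbb N^3$ has $q$ vertical inputs, one vertical output, $p$ horizontal inputs (left) and $r$ horizontal outputs (right). A *dg box operad* $\mathcal B$ consists of dg modules $\mathcal B(p,q,r)$, compositions $$\mu:\mathcal B(p,n,r)\otimes\bigotimes_{i=1}^n\mathcal B(p_{i-1},q_i,p_i)\to\mathcal B\Big(p+p_0,\sum_i q_i,r+p_n\Big)\qquad(n\ge 0)$$ and a unit $k\to\mathcal B(0,1,0)$, satisfying the usual associativity and unit axioms. Equivalently, it is an algebra over the $\mathbb N^3$-coloured symmetric operad of stackings of boxes: every stacking $S$ of boxes of colours $c_1,\dots,c_n$ forming a box of colour $c$ gives a map $\mu_S:\bigotimes_i\mathcal B(c_i)\to\mathcal B(c)$. A stacking is in standard order if every box precedes the boxes above it and those to the right of it. **Conilpotent box cooperads.** A *conilpotent dg box cooperad* $\mathcal C=\overline{\mathcal C}\oplus k$ (with $k$, spanned by the coaugmentation $\eta$, in colour $(0,1,0)$ and degree $0$) is given by a coalgebra $\overline{\mathcal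 C}$ over the comonad $M\mapsto\bigoplus_S\bigotimes_i M(c_i)$, where $S$ runs over the stackings in standard order with at least one box and the comultiplication decomposes stackings into substackings. Write $\Delta_S:\overline{\mathcal C}(c)\to\bigotimes_i\overline{\mathcal C}(c_i)$ for its components, extended by $0$ to $\eta$. Morphisms are the morphisms of such coalgebras, extended by the identity on $k$. **Thin-quadratic stackings.** A box $(p,q,r)$ is thin if $p=r=0$, semi-thin if exactly one of $p,r$ is $0$, and non-thin otherwise. Let $s_{\rm thin}^{-1}$ denote the desuspension in the thin colours only. A stacking $S$ in standard order of $n$ boxes, with result $(p,q,r)$, is thin-quadratic if it has no semi-thin boxes; if its degree, which is $0$ when $p=r=0$ and $1+\#\{\text{thin boxes}\}-n$ otherwise, equals $2-n$; and if the graph with the boxes as vertices and the horizontal wires between boxes as edges has exactly two connected components. Such $S$ is of type I (two thin boxes), type II (a non-thin bottom box and a thin box on top), or type III (a thin bottom box, all other boxes non-thin). The thin desuspended decomposition $\Delta^{s^{-1}}_{S}$ from $s_{\rm thin}^{-1}\mathcal C$ to the corresponding tensor product of $s_{\rm thin}^{-1}\mathcal C$'s is, with $\Delta_S(c)=\sum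 c_{(1)}\otimes\dots\otimes c_{(n)}$, $$\sum(-1)^{|c_{(1)}|}s^{-1}c_{(1)}\otimes s^{-1}c_{(2)},\qquad \sum(-1)^{|c_{(1)}|+1}c_{(1)}\otimes s^{-1}c_{(2)},\qquad -\sum s^{-1}c_{(1)}\otimes c_{(2)}\otimes\dots\otimes c_{(n)}$$ for the types I, II, III respectively. **Operations and twisting morphisms.** Let $\prod\mathrm{Hom}(s_{\rm thin}^{-1}\mathcal C,\mathcal B)$ be the graded module whose elements of degree $m$ are the families, indexed by the colours, of linear maps of degree $m$, with $d(f)=d_{\mathcal B}f-(-1)^{|f|}f\,d_{s_{\rm thin}^{-1}\mathcal C}$. For $n\ge 2$ put $$\mathsf sP_n(f_1,\dots,f_n)=(-1)^{\sum_i|f_i|}\sum_S\mu_S\circ(f_1\otimes\dots\otimes f_n)\circ\Delta^{s^{-1}}_S,\qquad \mathsf sL_n(f_1,\dots,f_n)=\sum_{\sigma\in\mathbb S_n}(-1)^{\sigma(f)}\,\mathsf sP_n(f_{\sigma(1)},\dots,f_{\sigma(n)}),$$ where $S$ runs over the thin-quadratic stackings of $n$ boxes and $(-1)^{\sigma(f)}$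 is the Koszul sign. A *twisting morphism* from $\mathcal C$ to $\mathcal B$ is an element $\alpha$ of degree $0$ with $\alpha\eta=0$ and $$d(\alpha)+\sum_{n\ge 2}\mathsf sP_n(\alpha,\dots,\alpha)=0;$$ the sum is finite on every element. Let $\mathrm{Tw}(\mathcal C,\mathcal B)$ be the set of twisting morphisms. **Proposition.** 1. There is a functor $\mathrm{Tw}:(\text{conilpotent dg box cooperads})^{\rm op}\times\text{dg box operads}\to\mathrm{Set}$ sending $(\mathcal C,\mathcal B)$ to $\mathrm{Tw}(\mathcal C,\mathcal B)$ and acting on morphisms by pre- and post-composition: $g:\mathcal C'\to\mathcal C$ and $f:\mathcal B\to\mathcal B'$ send $\alpha\in\mathrm{Tw}(\mathcal C,\mathcal B)$ to $f\circ\alpha\circ s_{\rm thin}^{-1}g\in\mathrm{Tw}(\mathcal C',\mathcal B')$. 2. For every conilpotent dg box cooperad $\mathcal C$ and every morphism $f:\mathcal B\to\mathcal B'$ of dg box operads, post-composition $$f\circ-:\prod\mathrm{Hom}(s_{\rm thin}^{-1}\mathcal C,\mathcal B)\to\prod\mathrm{Hom}(s_{\rm thin}^{-1}\mathcal C,\mathcal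 B')$$ is a strict morphism for the suspended $L_\infty$-structures $(d,(\mathsf sL_n)_{n\ge2})$, that is, a linear map of degree $0$ commuting with $d$ and with $\mathsf sL_n$ for all $n\ge2$. -/

import Mathlib

open CategoryTheory
open scoped TensorProduct DirectSum

universe u v w

namespace BoxOp

/-! ### Stackings of boxes: the coloured operad encoding box operads -/

/-- A colour of the operad: a box with `q` vertical inputs, one vertical output, `p` horizontal
inputs (left side) and `r` horizontal outputs (right side). -/
@[ext]
structure Arity : Type where
  p : ℕ
  q : ℕ
  r : ℕ

mutual
/-- Stackings with boxes labelled in `α`, up to the unit relations. Either `leaf`, the stacking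
without boxes (the unit, of arity `(0,1,0)`), or a bottom box `a` with a row of stackings on top of
it, one for every vertical input of `a`. An input without a box above it carries a `leaf`.
The planar tree underlying such a term is the vertical composite tree. -/
inductive Tree (α : Type) : Type
  | leaf : Tree α
  | node (a : α) (above : Row α) : Tree α
/-- A row of horizontally adjacent stackings, listed from left to right and closed on the right by
a vertical line `sky h` with label `h`. An empty row `sky h` consists of `h` horizontal wires
running over a top side with label `0` (a degenerate open space). -/
inductive Row (α : Type) : Type
  | sky (h : ℕ) : Row α
  | cons (t : Tree α) (rest : Row α) : Row α
end

section Trees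

variable {α β : Type}

/-- The number of stackings in a row. -/
def Row.length : Row α → ℕ
  | .sky _ => 0
  | .cons _ R => R.length + 1

mutual
/-- Relabelling of the boxes. -/
def Tree.map (f : α → β) : Tree α → Tree β
  | .leaf => .leaf
  | .node a R => .node (f a) (R.map f)
/-- Relabelling of the boxes in a row. -/
def Row.map (f : α → β) : Row α → Row β
  | .sky h => .sky h
  | .cons t R => .cons (t.map f) (R.map f)
end

mutual
/-- The boxes in standard order: a box precedes the boxes above it and those to the right of it. -/
def Tree.boxes : Tree α → List α
  | .leaf => []
  | .node a R => a :: R.boxes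
/-- The boxes of a row in standard order. -/
def Row.boxes : Row α → List α
  | .sky _ => []
  | .cons t R => t.boxes ++ R.boxes
end

mutual
/-- The number of vertical inputs of a stacking. -/
def Tree.top : Tree α → ℕ
  | .leaf => 1
  | .node _ R => R.top
/-- The number of vertical inputs of a row. -/
def Row.top : Row α → ℕ
  | .sky _ => 0
  | .cons t R => t.top + R.top
end

/- From here on every label `a : α` has a colour `c a`. -/
variable (c : α → Arity)

mutual
/-- The number of horizontal inputs of a stacking: those of the bottom box come first. -/
def Tree.left : Tree α → ℕ
  | .leaf => 0
  | .node a R => (c a).p + R.left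
/-- The label of the left side of a row. -/
def Row.left : Row α → ℕ
  | .sky h => h
  | .cons t _ => t.left
end

mutual
/-- The number of horizontal outputs of a stacking. -/
def Tree.right : Tree α → ℕ
  | .leaf => 0
  | .node a R => (c a).r + R.right
/-- The label of the right side of a row. -/
def Row.right : Row α → ℕ
  | .sky h => h
  | .cons _ R => R.right
end

mutual
/-- All sides match: over a box of colour `(p,q,r)` lies a row of `q` stackings, and in a row the
label of the right side of a stacking equals the label of the left side of what follows. -/
def Tree.Matching : Tree α → Prop
  | .leaf => True
  | .node a R => R.length = (c a).q ∧ R.Matching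
/-- All sides match in a row. -/
def Row.Matching : Row α → Prop
  | .sky _ => True
  | .cons t R => t.Matching ∧ R.Matching ∧ t.right c = R.left c
end

mutual
/-- `t.graft c Z` puts the row `Z` on top of `t`: the leaves of `t` are replaced, from left to
right, by the stackings in `Z`, and the label of every vertical line of `t` ending at the top
is increased by the label of the line of `Z` that continues it. The second component is the part of
`Z` that has not been used. -/
def Tree.graft : Tree α → Row α → Tree α × Row α
  | .leaf, .sky h => (.leaf, .sky h)
  | .leaf, .cons t Z => (t, Z)
  | .node a R, Z => (.node a (R.graft Z).1, (R.graft Z).2)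
/-- `R.graft c Z` puts the row `Z` on top of the row `R`. -/
def Row.graft : Row α → Row α → Row α × Row α
  | .sky h, Z => (.sky (h + Z.left c), Z)
  | .cons t R, Z => (.cons (t.graft Z).1 (R.graft (t.graft Z).2).1, (R.graft (t.graft Z).2).2)
end

mutual
/-- Substitution of the stackings `f a` into the boxes `a` of a stacking: the composition of the
operad of stackings. -/
def Tree.bind (f : β → Tree α) : Tree β → Tree α
  | .leaf => .leaf
  | .node b R => ((f b).graft c (R.bind f)).1
/-- Substitution of stackings into the boxes of a row. -/
def Row.bind (f : β → Tree α) : Row β → Row α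
  | .sky h => .sky h
  | .cons t R => .cons (t.bind f) (R.bind f)
end

mutual
/-- The horizontal wire at height `i` on the left side of a stacking ends either at the left side of
a box (`Sum.inl`) or at a height of the right side of the stacking (`Sum.inr`). -/
def Tree.leftEnd : Tree α → ℕ → α ⊕ ℕ
  | .leaf, i => .inr i
  | .node a R, i =>
      if i < (c a).p then .inl a else
        match R.leftEnd (i - (c a).p) with
        | .inl b => .inl b
        | .inr j => .inr ((c a).r + j)
/-- The same for the wires on the left side of a row. -/
def Row.leftEnd : Row α → ℕ → α ⊕ ℕ
  | .sky _, i => .inr i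
  | .cons t R, i =>
      match t.leftEnd i with
      | .inl b => .inl b
      | .inr j => R.leftEnd j
end

mutual
/-- The horizontal wire at height `j` on the right side of a stacking starts either at the right
side of a box (`Sum.inl`) or at a height of the left side of the stacking (`Sum.inr`). -/
def Tree.rightEnd : Tree α → ℕ → α ⊕ ℕ
  | .leaf, j => .inr j
  | .node a R, j =>
      if j < (c a).r then .inl a else
        match R.rightEnd (j - (c a).r) with
        | .inl b => .inl b
        | .inr i => .inr ((c a).p + i)
/-- The same for the wires on the right side of a row. -/
def Row.rightEnd : Row α → ℕ → α ⊕ ℕ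
  | .sky _, j => .inr j
  | .cons t R, j =>
      match R.rightEnd j with
      | .inl b => .inl b
      | .inr i => t.rightEnd i
end

mutual
/-- `t.HAdj c a b`: in the stacking `t` a horizontal wire runs from the right side of the box `a` to
the left side of the box `b`. -/
def Tree.HAdj : Tree α → α → α → Prop
  | .leaf, _, _ => False
  | .node _ R, a, b => R.HAdj a b
/-- Horizontal adjacency in a row. -/
def Row.HAdj : Row α → α → α → Prop
  | .sky _, _, _ => False
  | .cons t R, a, b => t.HAdj a b ∨ R.HAdj a b ∨
      ∃ i < t.right c, t.rightEnd c i = .inl a ∧ R.leftEnd c i = .inl b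
end

end Trees

/-- A row consisting of `n` leaves. -/
def Row.leaves (α : Type) : ℕ → Row α
  | 0 => .sky 0
  | n + 1 => .cons .leaf (Row.leaves α n)

theorem Row.leaves_spec {α : Type} (c : α → Arity) (n : ℕ) :
    (Row.leaves α n).length = n ∧ (Row.leaves α n).Matching c ∧ (Row.leaves α n).left c = 0 ∧
      (Row.leaves α n).right c = 0 ∧ (Row.leaves α n).top = n ∧ (Row.leaves α n).boxes = [] := by
  induction n with
  | zero => simp [Row.leaves, Row.length, Row.Matching, Row.left, Row.right, Row.top, Row.boxes]
  | succ n ih =>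
    obtain ⟨h1, h2, h3, h4, h5, h6⟩ := ih
    simp [Row.leaves, Row.length, Row.Matching, Row.left, Row.right, Row.top, Row.boxes,
      Tree.Matching, Tree.left, Tree.right, Tree.top, Tree.boxes, h1, h2, h3, h4, h5, h6, add_comm]

/-- `Stacking col out` is the set of stackings, in standard order, of `n` boxes with colours
`col 0, …, col (n - 1)` that form an `out`-labelled box. All other stackings of these boxes arise by
permuting the boxes, so these are the representatives of the orbits of the symmetric groups. -/
structure Stacking {n : ℕ} (col : Fin n → Arity) (out : Arity) : Type where
  tree : Tree (Fin n)
  matching : tree.Matching col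
  left_eq : tree.left col = out.p
  top_eq : tree.top = out.q
  right_eq : tree.right col = out.r
  standard : tree.boxes = List.finRange n

/-- The stacking consisting of a single box: the identity of the operad. -/
def Stacking.single (a : Arity) : Stacking (fun _ : Fin 1 => a) a where
  tree := .node 0 (Row.leaves _ a.q)
  matching := ⟨(Row.leaves_spec (fun _ : Fin 1 => a) _).1, (Row.leaves_spec _ _).2.1⟩
  left_eq := by simp [Tree.left, (Row.leaves_spec _ _).2.2.1]
  top_eq := by simp [Tree.top, (Row.leaves_spec (fun _ : Fin 1 => a) _).2.2.2.2.1]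
  right_eq := by simp [Tree.right, (Row.leaves_spec _ _).2.2.2.1]
  standard := by
    simp [Tree.boxes, (Row.leaves_spec (fun _ : Fin 1 => a) _).2.2.2.2.2, List.finRange]

/-- `IsComposite S T e U`: substituting the stackings `T i` into the boxes `i` of `S` gives the
stacking `U`, where `e` tells which box of which `T i` each box of `U` is. Given `S` and `T`, such a
pair `e`, `U` exists and is unique: `e` puts the boxes of the composite into standard order. -/
def IsComposite {n : ℕ} {col : Fin n → Arity} {out : Arity} {m : Fin n → ℕ}
    {col' : ∀ i, Fin (m i) → Arity} {N : ℕ} (S : Stacking col out)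
    (T : ∀ i, Stacking (col' i) (col i)) (e : Fin N ≃ Σ i, Fin (m i))
    (U : Stacking (fun l => col' (e l).1 (e l).2) out) : Prop :=
  U.tree = S.tree.bind (fun l => col' (e l).1 (e l).2)
    (fun i => (T i).tree.map fun j => e.symm ⟨i, j⟩)

/-- The horizontal composite graph of a stacking (without multiplicities). -/
def Stacking.horizontalGraph {n : ℕ} {col : Fin n → Arity} {out : Arity} (S : Stacking col out) :
    SimpleGraph (Fin n) :=
  SimpleGraph.fromRel fun a b => S.tree.HAdj col a b

/-- A box is thin if it has no horizontal inputs and outputs. -/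
def Arity.Thin (a : Arity) : Prop := a.p = 0 ∧ a.r = 0

/-- A box is semi-thin if exactly one of its horizontal sides has label `0`. -/
def Arity.SemiThin (a : Arity) : Prop := (a.p = 0 ∧ 0 < a.r) ∨ (0 < a.p ∧ a.r = 0)

open scoped Classical in
/-- The amount by which the thin desuspension shifts: `1` on thin arities and `0` otherwise. -/
noncomputable def Arity.thinShift (a : Arity) : ℤ := if a.Thin then 1 else 0

open scoped Classical in
/-- The thin desuspended degree of a stacking. -/
noncomputable def Stacking.thinDegree {n : ℕ} {col : Fin n → Arity} {out : Arity}
    (_ : Stacking col out) : ℤ :=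
  if out.Thin then 0 else 1 + ((Finset.univ.filter fun i => (col i).Thin).card : ℤ) - n

/-- Thin-quadratic stackings. (Stackings are in standard order by definition.) -/
structure Stacking.ThinQuadratic {n : ℕ} {col : Fin n → Arity} {out : Arity}
    (S : Stacking col out) : Prop where
  not_semiThin : ∀ i, ¬ (col i).SemiThin
  degree : S.thinDegree = 2 - n
  components : Nat.card S.horizontalGraph.ConnectedComponent = 2

/-- A thin-quadratic stacking is of type I if all of its (two) boxes are thin. -/
def Stacking.TypeI {n : ℕ} {col : Fin n → Arity} {out : Arity} (_ : Stacking col out) : Prop :=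
  ∀ i, (col i).Thin

/-- A thin-quadratic stacking is of type II if its bottom box is non-thin (the other box is then
thin). The thin-quadratic stackings which are neither of type I nor of type II are those of
type III: the bottom box is thin and all other boxes are non-thin. -/
def Stacking.TypeII {n : ℕ} {col : Fin n → Arity} {out : Arity} (_ : Stacking col out) : Prop :=
  ∃ i : Fin n, i.val = 0 ∧ ¬ (col i).Thin

mutual
theorem Tree.thin_of_left {α : Type} (c : α → Arity) : ∀ t : Tree α, t.Matching c →
    (∀ a ∈ t.boxes, ¬ (c a).SemiThin) → t.left c = 0 →
      t.right c = 0 ∧ ∀ a ∈ t.boxes, (c a).Thin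
  | .leaf => by simp [Tree.right, Tree.boxes]
  | .node a R => by
    intro h1 h2 h3
    simp only [Tree.Matching, Tree.boxes, List.mem_cons, forall_eq_or_imp, Tree.left,
      Tree.right] at h1 h2 h3 ⊢
    obtain ⟨g1, g2⟩ := Row.thin_of_left c R h1.2 h2.2 (by omega)
    have h4 := h2.1
    simp only [Arity.SemiThin] at h4
    exact ⟨by omega, ⟨by omega, by omega⟩, g2⟩
theorem Row.thin_of_left {α : Type} (c : α → Arity) : ∀ t : Row α, t.Matching c →
    (∀ a ∈ t.boxes, ¬ (c a).SemiThin) → t.left c = 0 →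
      t.right c = 0 ∧ ∀ a ∈ t.boxes, (c a).Thin
  | .sky h => by simp [Row.left, Row.right, Row.boxes]
  | .cons t R => by
    intro h1 h2 h3
    simp only [Row.Matching, Row.boxes, List.mem_append, Row.left, Row.right] at h1 h2 h3 ⊢
    obtain ⟨g1, g2⟩ := Tree.thin_of_left c t h1.1 (fun a ha => h2 a (Or.inl ha)) h3
    obtain ⟨g3, g4⟩ := Row.thin_of_left c R h1.2.1 (fun a ha => h2 a (Or.inr ha)) (by omega)
    exact ⟨g3, fun a ha => ha.elim (g2 a) (g4 a)⟩
end

/-- A thin-quadratic stacking has one thin box more than its outcome has. -/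
theorem Stacking.ThinQuadratic.sum_thinShift {n : ℕ} {col : Fin n → Arity} {out : Arity}
    {S : Stacking col out} (hS : S.ThinQuadratic) :
    ∑ i, (col i).thinShift = out.thinShift + 1 := by
  classical
  have hsum : ∑ i, (col i).thinShift =
      ((Finset.univ.filter fun i => (col i).Thin).card : ℤ) := by
    simp [Arity.thinShift]
  have hd := hS.degree
  rw [hsum]
  unfold Stacking.thinDegree at hd
  unfold Arity.thinShift
  by_cases h : out.Thin
  · have hall : ∀ i, (col i).Thin := fun i =>
      (Tree.thin_of_left col S.tree S.matching (fun a _ => hS.not_semiThin a)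
        (by rw [S.left_eq]; exact h.1)).2 i (by rw [S.standard]; simp)
    rw [if_pos h] at hd ⊢
    have : (Finset.univ.filter fun i => (col i).Thin) = Finset.univ := by simp [hall]
    rw [this]
    simp only [Finset.card_univ, Fintype.card_fin]
    omega
  · rw [if_neg h] at hd ⊢
    omega

/-! ### Differential graded modules -/

noncomputable section

/-- A dg module over `k`: a module which is the direct sum of its submodules `deg n`, `n : ℤ`, with
a differential of degree `-1`. -/
structure DGMod (k : Type u) [Field k] : Type (max u (v + 1)) where
  carrier : Type v
  [addCommGroup : AddCommGroup carrier]
  [module : Module k carrier]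
  deg : ℤ → Submodule k carrier
  internal : DirectSum.IsInternal deg
  d : carrier →ₗ[k] carrier
  d_mem : ∀ n x, x ∈ deg n → d x ∈ deg (n - 1)
  d_d : ∀ x, d (d x) = 0

attribute [instance] DGMod.addCommGroup DGMod.module

instance {k : Type u} [Field k] : CoeSort (DGMod.{u, v} k) (Type v) := ⟨DGMod.carrier⟩

/-- The sign `(-1)^m`. -/
def sg (k : Type u) [Field k] (m : ℤ) : k := if Even m then 1 else -1

namespace DGMod

variable {k : Type u} [Field k]

/-- The linear operator which multiplies an element of degree `n` by the scalar `s n`. -/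
def diag (V : DGMod.{u, v} k) (s : ℤ → k) : V →ₗ[k] V :=
  letI := V.internal.chooseDecomposition
  DirectSum.toModule k ℤ V (fun n => s n • (V.deg n).subtype) ∘ₗ
    (DirectSum.decomposeLinearEquiv V.deg).toLinearMap

theorem diag_of_mem (V : DGMod.{u, v} k) (s : ℤ → k) {n : ℤ} {x : V} (hx : x ∈ V.deg n) :
    V.diag s x = s n • x := by
  let _ := V.internal.chooseDecomposition
  have h := DirectSum.decomposeLinearEquiv_apply_coe (R := k) V.deg n ⟨x, hx⟩
  simp only at h
  simp only [diag, LinearMap.comp_apply, LinearEquiv.coe_coe]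
  rw [h, DirectSum.toModule_lof]
  simp

/-- The `t`-fold desuspension: an element of degree `n` in `V` gets degree `n - t`, and the
differential is multiplied by `(-1)^t`. -/
def desusp (V : DGMod.{u, v} k) (t : ℤ) : DGMod.{u, v} k where
  carrier := V
  deg n := V.deg (n + t)
  internal := by
    have h := V.internal
    rw [DirectSum.isInternal_submodule_iff_iSupIndep_and_iSup_eq_top] at h ⊢
    exact ⟨h.1.comp (add_left_injective t),
      ((Equiv.addRight t).iSup_comp (g := V.deg)).trans h.2⟩
  d := sg k t • V.d
  d_mem n x hx := by
    have h := V.d_mem _ x hx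
    rw [show n + t - 1 = n - 1 + t by ring] at h
    exact Submodule.smul_mem _ _ h
  d_d x := by simp [V.d_d]

/-- The direct sum of two dg modules. -/
def prod (V : DGMod.{u, v} k) (W : DGMod.{u, w} k) : DGMod.{u, max v w} k where
  carrier := V × W
  deg n := (V.deg n).prod (W.deg n)
  internal := by
    let _ := V.internal.chooseDecomposition
    let _ := W.internal.chooseDecomposition
    refine @DirectSum.Decomposition.isInternal _ _ _ _ _ _ _ _
      (DirectSum.Decomposition.ofLinearMap (R := k) _
        (LinearMap.coprod
          (DirectSum.toModule k ℤ _ (fun n =>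
            DirectSum.lof k ℤ (fun n => ↥((V.deg n).prod (W.deg n))) n ∘ₗ
              LinearMap.codRestrict ((V.deg n).prod (W.deg n))
                (LinearMap.inl k V W ∘ₗ (V.deg n).subtype) (fun x => by simp)) ∘ₗ
            (DirectSum.decomposeLinearEquiv V.deg).toLinearMap)
          (DirectSum.toModule k ℤ _ (fun n =>
            DirectSum.lof k ℤ (fun n => ↥((V.deg n).prod (W.deg n))) n ∘ₗ
              LinearMap.codRestrict ((V.deg n).prod (W.deg n))
                (LinearMap.inr k V W ∘ₗ (W.deg n).subtype) (fun x => by simp)) ∘ₗ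
            (DirectSum.decomposeLinearEquiv W.deg).toLinearMap)) ?_ ?_)
    · apply LinearMap.prod_ext
      · apply DirectSum.decompose_lhom_ext V.deg
        intro n
        ext x <;> simp <;> rfl
      · apply DirectSum.decompose_lhom_ext W.deg
        intro n
        ext x <;> simp <;> rfl
    · refine DirectSum.linearMap_ext _ fun n => LinearMap.ext ?_
      rintro ⟨⟨x, y⟩, hx, hy⟩
      have h1 := DirectSum.decomposeLinearEquiv_apply_coe (R := k) V.deg n ⟨x, hx⟩
      have h2 := DirectSum.decomposeLinearEquiv_apply_coe (R := k) W.deg n ⟨y, hy⟩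
      simp only at h1 h2
      simp only [LinearMap.comp_apply, DirectSum.coeLinearMap_lof, LinearMap.coprod_apply,
        LinearEquiv.coe_coe, LinearMap.id_apply]
      rw [h1, h2, DirectSum.toModule_lof, DirectSum.toModule_lof, LinearMap.comp_apply,
        LinearMap.comp_apply, ← map_add]
      congr 1
      ext
      · exact add_zero x
      · exact zero_add y
  d := V.d.prodMap W.d
  d_mem n x hx := ⟨V.d_mem n _ hx.1, W.d_mem n _ hx.2⟩
  d_d x := by ext <;> simp [V.d_d, W.d_d]

/-- The ground field in degree `0` if `P` holds, and the zero module otherwise. -/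
def ground (k : Type u) [Field k] (P : Prop) : DGMod.{u, u} k where
  carrier := {x : k // x ∈ (⨆ _ : P, ⊤ : Submodule k k)}
  deg n := if n = 0 then ⊤ else ⊥
  internal := by
    rw [DirectSum.isInternal_submodule_iff_iSupIndep_and_iSup_eq_top]
    constructor
    · intro i
      by_cases h : i = 0
      · subst h
        rw [show (⨆ j, ⨆ (_ : j ≠ (0 : ℤ)), if j = 0 then (⊤ : Submodule k
          {x : k // x ∈ (⨆ _ : P, ⊤ : Submodule k k)}) else ⊥) = ⊥ by
            simp only [iSup_eq_bot]; intro j hj; simp [hj]]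
        exact disjoint_bot_right
      · simp [h]
    · exact eq_top_iff.mpr (le_iSup_of_le 0 (by simp))
  d := 0
  d_mem n x _ := by simp
  d_d x := by simp

section Tensor

variable {n : ℕ} (V : Fin n → DGMod.{u, v} k)

/-- The elements of degree `m` in the tensor product of dg modules. -/
def tensorDeg (m : ℤ) : Submodule k (⨂[k] i, V i) :=
  Submodule.span k {t | ∃ (g : Fin n → ℤ) (x : ∀ i, V i),
    (∀ i, x i ∈ (V i).deg (g i)) ∧ ∑ i, g i = m ∧ t = PiTensorProduct.tprod k x}

/-- The differential of the tensor product of dg modules, with Koszul signs: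
`d (x₀ ⊗ ⋯) = ∑ i, (-1)^(|x₀| + ⋯ + |xᵢ₋₁|) x₀ ⊗ ⋯ ⊗ d xᵢ ⊗ ⋯`. -/
def tensorD : (⨂[k] i, V i) →ₗ[k] ⨂[k] i, V i :=
  ∑ i, PiTensorProduct.map fun j =>
    if j < i then (V j).diag (sg k) else if j = i then (V j).d else LinearMap.id

/-- The tensor product of maps `f i` of degree `g i`, with Koszul signs: `x₀ ⊗ x₁ ⊗ ⋯` is sent to
`f₀ x₀ ⊗ f₁ x₁ ⊗ ⋯` times the product of the signs `(-1)^(|fᵢ||xⱼ|)` over all `j < i`. -/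
def tensorMap {W : Fin n → DGMod.{u, w} k} (g : Fin n → ℤ) (f : ∀ i, V i →ₗ[k] W i) :
    (⨂[k] i, V i) →ₗ[k] ⨂[k] i, W i :=
  PiTensorProduct.map fun j =>
    f j ∘ₗ (V j).diag fun m => sg k ((∑ i ∈ Finset.univ.filter (j < ·), g i) * m)

/-- The Koszul sign operator of a rearrangement: the homogeneous element `x₀ ⊗ x₁ ⊗ ⋯` is
multiplied by the product of the signs `(-1)^(|xᵢ||xⱼ|)` over all pairs `i < j` with
`pos j < pos i`. (The sum runs over all choices `ε` of a parity in every factor.) -/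
def koszul (pos : Fin n → ℕ) : (⨂[k] i, V i) →ₗ[k] ⨂[k] i, V i :=
  ∑ ε : Fin n → Bool,
    (∏ i, ∏ j, if i < j ∧ pos j < pos i ∧ ε i = true ∧ ε j = true then (-1 : k) else 1) •
      PiTensorProduct.map fun i => (V i).diag fun m => if decide (Odd m) = ε i then 1 else 0

end Tensor

/-- The canonical map `⨂_{(i,j)} V i j → ⨂_i ⨂_j V i j`, without signs. -/
def nest {n : ℕ} {m : Fin n → ℕ} (V : ∀ i, Fin (m i) → DGMod.{u, v} k) :
    (⨂[k] s : (Σ i, Fin (m i)), V s.1 s.2) →ₗ[k] ⨂[k] i, ⨂[k] j, V i j :=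
  PiTensorProduct.lift
    { toFun := fun x => PiTensorProduct.tprod k fun i => PiTensorProduct.tprod k fun j => x ⟨i, j⟩
      map_update_add' := by
        intro _ x s a b
        obtain ⟨i, j⟩ := s
        have key : ∀ y : V i j, (fun i' => PiTensorProduct.tprod k fun j' => Function.update x ⟨i, j⟩ y ⟨i', j'⟩) =
            Function.update (fun i' => PiTensorProduct.tprod k fun j' => x ⟨i', j'⟩) i
              (PiTensorProduct.tprod k (Function.update (fun j' => x ⟨i, j'⟩) j y)) := by
          intro y
          funext i'
          by_cases h : i' = i
          · subst h
            rw [Function.update_self]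
            congr 1
            funext j'
            by_cases h' : j' = j
            · subst h'; simp
            · rw [Function.update_of_ne h', Function.update_of_ne (by simpa using h')]
          · rw [Function.update_of_ne h]
            congr 1
            funext j'
            rw [Function.update_of_ne (by simp [h])]
        convert (PiTensorProduct.tprod k).map_update_add (fun i' => PiTensorProduct.tprod k fun j' => x ⟨i', j'⟩) i
            (PiTensorProduct.tprod k (Function.update (fun j' => x ⟨i, j'⟩) j a))
            (PiTensorProduct.tprod k (Function.update (fun j' => x ⟨i, j'⟩) j b)) using 2
        · rw [← MultilinearMap.map_update_add, ← key]
        · rw [← key]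
        · rw [← key]
      map_update_smul' := by
        intro _ x s a b
        obtain ⟨i, j⟩ := s
        have key : ∀ y : V i j, (fun i' => PiTensorProduct.tprod k fun j' => Function.update x ⟨i, j⟩ y ⟨i', j'⟩) =
            Function.update (fun i' => PiTensorProduct.tprod k fun j' => x ⟨i', j'⟩) i
              (PiTensorProduct.tprod k (Function.update (fun j' => x ⟨i, j'⟩) j y)) := by
          intro y
          funext i'
          by_cases h : i' = i
          · subst h
            rw [Function.update_self]
            congr 1
            funext j'
            by_cases h' : j' = j
            · subst h'; simp
            · rw [Function.update_of_ne h', Function.update_of_ne (by simpa using h')]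
          · rw [Function.update_of_ne h]
            congr 1
            funext j'
            rw [Function.update_of_ne (by simp [h])]
        convert (PiTensorProduct.tprod k).map_update_smul (fun i' => PiTensorProduct.tprod k fun j' => x ⟨i', j'⟩) i a
            (PiTensorProduct.tprod k (Function.update (fun j' => x ⟨i, j'⟩) j b)) using 2
        · rw [← MultilinearMap.map_update_smul, ← key]
        · rw [← key] }

/-- Rearrangement of the factors of a tensor product along `e`, with Koszul sign, followed by
bracketing: `⨂_l V (e l) → ⨂_i ⨂_j V i j`. -/
def regroup {n N : ℕ} {m : Fin n → ℕ} (V : ∀ i, Fin (m i) → DGMod.{u, v} k)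
    (e : Fin N ≃ Σ i, Fin (m i)) :
    (⨂[k] l, V (e l).1 (e l).2) →ₗ[k] ⨂[k] i, ⨂[k] j, V i j :=
  nest V ∘ₗ
    (PiTensorProduct.reindex k (fun s : (Σ i, Fin (m i)) => (V s.1 s.2 : Type v))
      e.symm).symm.toLinearMap ∘ₗ
    koszul (fun l => V (e l).1 (e l).2) (fun l => (finSigmaFinEquiv (e l) : ℕ))

end DGMod

/-! ### dg box operads -/

/-- A dg box operad: an algebra over the operad of stackings. For the stacking without boxes, `μ` is
the unit `k → M (0,1,0)`. -/
structure BoxOperad (k : Type u) [Field k] : Type (max u (w + 1)) where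
  M : Arity → DGMod.{u, w} k
  μ : ∀ {n : ℕ} {col : Fin n → Arity} {out : Arity}, Stacking col out →
    ((⨂[k] i, M (col i)) →ₗ[k] M out)
  μ_mem : ∀ {n : ℕ} {col : Fin n → Arity} {out : Arity} (S : Stacking col out) (j : ℤ)
    (t : ⨂[k] i, M (col i)), t ∈ DGMod.tensorDeg (fun i => M (col i)) j → μ S t ∈ (M out).deg j
  μ_d : ∀ {n : ℕ} {col : Fin n → Arity} {out : Arity} (S : Stacking col out)
    (t : ⨂[k] i, M (col i)), μ S (DGMod.tensorD (fun i => M (col i)) t) = (M out).d (μ S t)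
  μ_single : ∀ (a : Arity) (x : M a),
    μ (Stacking.single a) (PiTensorProduct.tprod k fun _ => x) = x
  μ_comp : ∀ {n : ℕ} {col : Fin n → Arity} {out : Arity} {m : Fin n → ℕ}
    {col' : ∀ i, Fin (m i) → Arity} {N : ℕ} (S : Stacking col out)
    (T : ∀ i, Stacking (col' i) (col i)) (e : Fin N ≃ Σ i, Fin (m i))
    (U : Stacking (fun l => col' (e l).1 (e l).2) out), IsComposite S T e U →
    ∀ t : ⨂[k] l, M (col' (e l).1 (e l).2),
      μ U t = μ S (PiTensorProduct.map (fun i => μ (T i))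
        (DGMod.regroup (fun i j => M (col' i j)) e t))

namespace BoxOperad

variable {k : Type u} [Field k]

/-- Morphisms of dg box operads. -/
@[ext]
structure Hom (B B' : BoxOperad.{u, w} k) : Type w where
  f : ∀ a, B.M a →ₗ[k] B'.M a
  f_mem : ∀ a n x, x ∈ (B.M a).deg n → f a x ∈ (B'.M a).deg n
  f_d : ∀ a x, f a ((B.M a).d x) = (B'.M a).d (f a x)
  f_μ : ∀ {n : ℕ} {col : Fin n → Arity} {out : Arity} (S : Stacking col out)
    (t : ⨂[k] i, B.M (col i)),
    f out (B.μ S t) = B'.μ S (PiTensorProduct.map (fun i => f (col i)) t)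

instance : Category.{w} (BoxOperad.{u, w} k) where
  Hom := Hom
  id B :=
    { f := fun _ => LinearMap.id
      f_mem := fun _ _ _ h => h
      f_d := fun _ _ => rfl
      f_μ := fun S t => by rw [PiTensorProduct.map_id]; rfl }
  comp g h :=
    { f := fun a => h.f a ∘ₗ g.f a
      f_mem := fun a n x hx => h.f_mem a n _ (g.f_mem a n x hx)
      f_d := fun a x => by simp [g.f_d, h.f_d]
      f_μ := fun S t => by
        rw [PiTensorProduct.map_comp, LinearMap.comp_apply, LinearMap.comp_apply, g.f_μ, h.f_μ] }

end BoxOperad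

/-! ### Conilpotent dg box cooperads -/

/-- The stackings with at least one box that form an `out`-labelled box. -/
abbrev StackingsTo (out : Arity) : Type :=
  Σ (n : ℕ) (col : Fin (n + 1) → Arity), Stacking col out

/-- The comonad of conilpotent box cooperads on objects: the cofree conilpotent box cooperad on `M`,
in arity `out`, is the direct sum over all stackings `S` with at least one box (one representative
in standard order for every orbit of the symmetric groups) of the tensor product of the modules
`M` at the colours of the boxes of `S`. -/
abbrev cofree {k : Type u} [Field k] (M : Arity → DGMod.{u, v} k) (out : Arity) : Type (max u v) :=
  ⨁ S : StackingsTo out, ⨂[k] i, M (S.2.1 i)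

/-- A conilpotent dg box cooperad, given by its coaugmentation coideal `M`: a coalgebra over the
comonad `cofree`. The comultiplication of that comonad sends the summand of a stacking `U` to
the summands of all the ways to obtain `U` by substituting stackings `T i` into the boxes `i` of a
stacking `S`, so that coassociativity is the condition `Δ_comp`. -/
structure ConilCooperad (k : Type u) [Field k] : Type (max u (v + 1)) where
  M : Arity → DGMod.{u, v} k
  Δ : ∀ a : Arity, M a →ₗ[k] cofree M a
  Δ_mem : ∀ (a : Arity) (j : ℤ) (x : M a), x ∈ (M a).deg j →
    ∀ S : StackingsTo a, Δ a x S ∈ DGMod.tensorDeg (fun i => M (S.2.1 i)) j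
  Δ_d : ∀ (a : Arity) (x : M a) (S : StackingsTo a),
    Δ a ((M a).d x) S = DGMod.tensorD (fun i => M (S.2.1 i)) (Δ a x S)
  Δ_single : ∀ (a : Arity) (x : M a),
    Δ a x ⟨0, fun _ => a, Stacking.single a⟩ = PiTensorProduct.tprod k fun _ => x
  Δ_comp : ∀ {n : ℕ} {col : Fin (n + 1) → Arity} {out : Arity} {m : Fin (n + 1) → ℕ}
    {col' : ∀ i, Fin (m i + 1) → Arity} {N : ℕ} (S : Stacking col out)
    (T : ∀ i, Stacking (col' i) (col i)) (e : Fin (N + 1) ≃ Σ i, Fin (m i + 1))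
    (U : Stacking (fun l => col' (e l).1 (e l).2) out), IsComposite S T e U →
    ∀ x : M out,
      DGMod.regroup (fun i j => M (col' i j)) e
          (Δ out x ⟨N, fun l => col' (e l).1 (e l).2, U⟩) =
        PiTensorProduct.map
          (fun i => DirectSum.component k (StackingsTo (col i)) _ ⟨m i, col' i, T i⟩ ∘ₗ Δ (col i))
          (Δ out x ⟨n, col, S⟩)

namespace ConilCooperad

variable {k : Type u} [Field k]

/-- Morphisms of conilpotent dg box cooperads. -/
@[ext]
structure Hom (C C' : ConilCooperad.{u, v} k) : Type v where
  f : ∀ a, C.M a →ₗ[k] C'.M a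
  f_mem : ∀ a n x, x ∈ (C.M a).deg n → f a x ∈ (C'.M a).deg n
  f_d : ∀ a x, f a ((C.M a).d x) = (C'.M a).d (f a x)
  f_Δ : ∀ (a : Arity) (x : C.M a) (S : StackingsTo a),
    C'.Δ a (f a x) S = PiTensorProduct.map (fun i => f (S.2.1 i)) (C.Δ a x S)

instance : Category.{v} (ConilCooperad.{u, v} k) where
  Hom := Hom
  id C :=
    { f := fun _ => LinearMap.id
      f_mem := fun _ _ _ h => h
      f_d := fun _ _ => rfl
      f_Δ := fun a x S => by rw [PiTensorProduct.map_id]; rfl }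
  comp g h :=
    { f := fun a => h.f a ∘ₗ g.f a
      f_mem := fun a n x hx => h.f_mem a n _ (g.f_mem a n x hx)
      f_d := fun a x => by simp [g.f_d, h.f_d]
      f_Δ := fun a x S => by
        rw [PiTensorProduct.map_comp, LinearMap.comp_apply, LinearMap.comp_apply, h.f_Δ, g.f_Δ] }

/-- The dg modules underlying the coaugmented cooperad: the coaugmentation coideal plus the ground
field, spanned by the coaugmentation, in arity `(0,1,0)`. -/
def full (C : ConilCooperad.{u, v} k) (a : Arity) : DGMod.{u, max u v} k :=
  (C.M a).prod (DGMod.ground k (a = ⟨0, 1, 0⟩))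

/-- The thin desuspension of the coaugmented cooperad: desuspended once in the thin arities. -/
def thinDesusp (C : ConilCooperad.{u, v} k) (a : Arity) : DGMod.{u, max u v} k :=
  (C.full a).desusp a.thinShift

/-- The inclusion of the coaugmentation coideal in the thin desuspension (shifting degrees in the
thin arities). -/
def incl (C : ConilCooperad.{u, v} k) (a : Arity) : C.M a →ₗ[k] C.thinDesusp a :=
  LinearMap.inl k (C.M a) (DGMod.ground k (a = ⟨0, 1, 0⟩))

/-- The projection of the thin desuspension onto the coaugmentation coideal. -/
def proj (C : ConilCooperad.{u, v} k) (a : Arity) : C.thinDesusp a →ₗ[k] C.M a :=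
  LinearMap.fst k (C.M a) (DGMod.ground k (a = ⟨0, 1, 0⟩))

/-- The inclusion of (the ground field spanned by) the coaugmentation. -/
def coaug (C : ConilCooperad.{u, v} k) (a : Arity) :
    DGMod.ground k (a = ⟨0, 1, 0⟩) →ₗ[k] C.thinDesusp a :=
  LinearMap.inr k (C.M a) (DGMod.ground k (a = ⟨0, 1, 0⟩))

/-- The map induced on thin desuspensions by a morphism of conilpotent dg box cooperads. -/
def mapThinDesusp {C C' : ConilCooperad.{u, v} k} (g : C ⟶ C') (a : Arity) :
    C.thinDesusp a →ₗ[k] C'.thinDesusp a :=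
  LinearMap.prodMap (M := C.M a) (M₃ := C'.M a) (Hom.f g a)
    (LinearMap.id (M := DGMod.ground k (a = ⟨0, 1, 0⟩)))

open scoped Classical in
/-- The passage from the component of the comultiplication at a thin-quadratic stacking `S` to the
thin desuspended infinitesimal decomposition. For the types I, II, III, a tensor
`c₀ ⊗ c₁ ⊗ ⋯` of homogeneous elements is sent to
`(-1)^|c₀| s⁻¹c₀ ⊗ s⁻¹c₁`, `(-1)^(|c₀|+1) c₀ ⊗ s⁻¹c₁` and `- s⁻¹c₀ ⊗ c₁ ⊗ c₂ ⊗ ⋯` respectively. -/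
def desuspend (C : ConilCooperad.{u, v} k) {n : ℕ} {col : Fin n → Arity} {out : Arity}
    (S : Stacking col out) : (⨂[k] i, C.M (col i)) →ₗ[k] ⨂[k] i, C.thinDesusp (col i) :=
  if S.TypeI then
    PiTensorProduct.map fun i =>
      C.incl (col i) ∘ₗ if i.val = 0 then (C.M (col i)).diag (sg k) else LinearMap.id
  else if S.TypeII then
    - PiTensorProduct.map fun i =>
      C.incl (col i) ∘ₗ if i.val = 0 then (C.M (col i)).diag (sg k) else LinearMap.id
  else
    - PiTensorProduct.map fun i => C.incl (col i)

end ConilCooperad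

/-! ### The convolution module and its operations -/

section Convolution

variable {k : Type u} [Field k]

/-- The families of linear maps from the thin desuspension of `C` to `B`. -/
abbrev Conv (C : ConilCooperad.{u, v} k) (B : BoxOperad.{u, w} k) : Type (max u v w) :=
  ∀ a : Arity, C.thinDesusp a →ₗ[k] B.M a

namespace Conv

variable {C C' : ConilCooperad.{u, v} k} {B B' : BoxOperad.{u, w} k}

/-- The families of linear maps of degree `m`. -/
def homDeg (C : ConilCooperad.{u, v} k) (B : BoxOperad.{u, w} k) (m : ℤ) :
    Submodule k (Conv C B) where
  carrier := {f | ∀ a n x, x ∈ (C.thinDesusp a).deg n → f a x ∈ (B.M a).deg (n + m)}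
  add_mem' hf hg a n x hx := Submodule.add_mem _ (hf a n x hx) (hg a n x hx)
  zero_mem' _ _ _ _ := Submodule.zero_mem _
  smul_mem' r _ hf a n x hx := Submodule.smul_mem _ r (hf a n x hx)

/-- The differential `d f = d_B f - (-1)^m f d_C` of families of maps of degree `m`. -/
def homD (C : ConilCooperad.{u, v} k) (B : BoxOperad.{u, w} k) (m : ℤ) :
    Conv C B →ₗ[k] Conv C B where
  toFun f a := (B.M a).d ∘ₗ f a - sg k m • (f a ∘ₗ (C.thinDesusp a).d)
  map_add' f g := by
    funext a
    ext x
    simp [smul_add]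
    abel
  map_smul' r f := by
    funext a
    ext x
    simp [smul_sub, smul_comm r]

/-- The summand of `sP_n (f_1, …, f_n)` at a stacking `S`: the composite of the thin desuspended
infinitesimal decomposition, the tensor product of the maps `f_i` and the composition of `B`, if `S`
is thin-quadratic and has `n` boxes, and zero otherwise. -/
def sPTerm (n : ℕ) (m : Fin n → ℤ) (f : Fin n → Conv C B) (a : Arity) (S : StackingsTo a)
    [Decidable (S.1 + 1 = n ∧ S.2.2.ThinQuadratic)] :
    (⨂[k] i, C.M (S.2.1 i)) →ₗ[k] B.M a :=
  if h : S.1 + 1 = n ∧ S.2.2.ThinQuadratic then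
    B.μ S.2.2 ∘ₗ
      DGMod.tensorMap (fun i => C.thinDesusp (S.2.1 i)) (W := fun i => B.M (S.2.1 i))
        (fun i => m (Fin.cast h.1 i)) (fun i => f (Fin.cast h.1 i) (S.2.1 i)) ∘ₗ
      C.desuspend S.2.2
  else 0

open scoped Classical in
/-- The operation `sP_n` on families of maps `f_1, …, f_n` of degrees `m_1, …, m_n`. -/
def sP (n : ℕ) (m : Fin n → ℤ) (f : Fin n → Conv C B) : Conv C B := fun a =>
  sg k (∑ i, m i) • (DirectSum.toModule k (StackingsTo a) (B.M a) (fun S => sPTerm n m f a S) ∘ₗ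
    C.Δ a ∘ₗ C.proj a)

/-- The Koszul sign of the permutation `(f_1, …, f_n) ↦ (f_{σ 1}, …, f_{σ n})` of elements of degrees
`m_1, …, m_n`. -/
def permSign (k : Type u) [Field k] {n : ℕ} (m : Fin n → ℤ) (σ : Equiv.Perm (Fin n)) : k :=
  ∏ i, ∏ j, if i < j ∧ σ j < σ i then sg k (m (σ i) * m (σ j)) else 1

/-- The operation `sL_n` on families of maps `f_1, …, f_n` of degrees `m_1, …, m_n`. -/
def sL (n : ℕ) (m : Fin n → ℤ) (f : Fin n → Conv C B) : Conv C B :=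
  ∑ σ : Equiv.Perm (Fin n), permSign k m σ • sP n (fun i => m (σ i)) (fun i => f (σ i))

/-- Post-composition with a morphism of dg box operads. -/
def postcomp (f : B ⟶ B') (h : Conv C B) : Conv C B' := fun a => BoxOperad.Hom.f f a ∘ₗ h a

/-- Pre-composition with a morphism of conilpotent dg box cooperads. -/
def precomp (g : C' ⟶ C) (h : Conv C B) : Conv C' B := fun a =>
  h a ∘ₗ ConilCooperad.mapThinDesusp g a

end Conv

theorem DGMod.map_mem_tensorDeg {n : ℕ} {V : Fin n → DGMod.{u, v} k} {W : Fin n → DGMod.{u, w} k}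
    (g : Fin n → ℤ) (f : ∀ i, V i →ₗ[k] W i)
    (hf : ∀ i l x, x ∈ (V i).deg l → f i x ∈ (W i).deg (l + g i)) (j j' : ℤ)
    (hj : j' = j + ∑ i, g i) (t : ⨂[k] i, V i) (ht : t ∈ DGMod.tensorDeg V j) :
    PiTensorProduct.map f t ∈ DGMod.tensorDeg W j' := by
  suffices h : DGMod.tensorDeg V j ≤ (DGMod.tensorDeg W j').comap (PiTensorProduct.map f) from h ht
  refine Submodule.span_le.mpr ?_
  rintro _ ⟨l, x, hx, hl, rfl⟩
  refine Submodule.subset_span ⟨fun i => l i + g i, fun i => f i (x i), fun i => hf i _ _ (hx i),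
    ?_, by simp⟩
  rw [Finset.sum_add_distrib, hl, hj]

theorem DGMod.diag_mem (V : DGMod.{u, v} k) (s : ℤ → k) {l : ℤ} {x : V} (hx : x ∈ V.deg l) :
    V.diag s x ∈ V.deg l := by
  rw [V.diag_of_mem s hx]
  exact Submodule.smul_mem _ _ hx

theorem ConilCooperad.incl_mem (C : ConilCooperad.{u, v} k) (a : Arity) {l : ℤ} {x : C.M a}
    (hx : x ∈ (C.M a).deg l) : C.incl a x ∈ (C.thinDesusp a).deg (l + -a.thinShift) := by
  refine ⟨?_, Submodule.zero_mem _⟩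
  rw [show l + -a.thinShift + a.thinShift = l by ring]
  exact hx

theorem ConilCooperad.desuspend_mem (C : ConilCooperad.{u, v} k) {n : ℕ} {col : Fin n → Arity}
    {out : Arity} (S : Stacking col out) (j : ℤ) (t : ⨂[k] i, C.M (col i))
    (ht : t ∈ DGMod.tensorDeg (fun i => C.M (col i)) j) :
    C.desuspend S t ∈
      DGMod.tensorDeg (fun i => C.thinDesusp (col i)) (j - ∑ i, (col i).thinShift) := by
  have hj : j - ∑ i, (col i).thinShift = j + ∑ i, -(col i).thinShift := by
    rw [Finset.sum_neg_distrib]; ring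
  have key : ∀ f : ∀ i, C.M (col i) →ₗ[k] C.M (col i),
      (∀ i l x, x ∈ (C.M (col i)).deg l → f i x ∈ (C.M (col i)).deg l) →
      PiTensorProduct.map (fun i => C.incl (col i) ∘ₗ f i) t ∈
        DGMod.tensorDeg (fun i => C.thinDesusp (col i)) (j - ∑ i, (col i).thinShift) :=
    fun f hf => DGMod.map_mem_tensorDeg (fun i => -(col i).thinShift) _
      (fun i l x hx => C.incl_mem (col i) (x := f i x) (hf i l x hx)) j _ hj t ht
  have hsign : ∀ (i : Fin n) (l : ℤ) (x : C.M (col i)), x ∈ (C.M (col i)).deg l →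
      (if i.val = 0 then (C.M (col i)).diag (sg k) else LinearMap.id) x ∈ (C.M (col i)).deg l := by
    intro i l x hx
    split_ifs
    · exact DGMod.diag_mem _ _ hx
    · exact hx
  unfold ConilCooperad.desuspend
  split_ifs
  · exact key _ hsign
  · exact Submodule.neg_mem _ (key _ hsign)
  · exact Submodule.neg_mem _ (key (fun _ => LinearMap.id) fun _ _ _ hx => hx)

namespace Conv

variable {C C' : ConilCooperad.{u, v} k} {B B' : BoxOperad.{u, w} k}

open scoped Classical in
theorem sP_mem (n : ℕ) (m : Fin n → ℤ) (f : Fin n → Conv C B) (hf : ∀ i, f i ∈ homDeg C B (m i)) :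
    sP n m f ∈ homDeg C B (∑ i, m i - 1) := by
  intro a j x hx
  have hx' : C.proj a x ∈ (C.M a).deg (j + a.thinShift) := hx.1
  refine Submodule.smul_mem _ _ ?_
  simp only [LinearMap.comp_apply]
  have hsum : ∀ y : cofree C.M a, DirectSum.toModule k (StackingsTo a) (B.M a)
      (fun S => sPTerm n m f a S) y = ∑ S ∈ DFinsupp.support y, sPTerm n m f a S (y S) := by
    intro y
    conv_lhs => rw [← DirectSum.sum_support_of y]
    rw [map_sum]
    exact Finset.sum_congr rfl fun S _ =>
      DirectSum.toModule_lof k (φ := fun S => sPTerm n m f a S) S (y S)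
  rw [hsum]
  refine Submodule.sum_mem _ fun S _ => ?_
  unfold sPTerm
  split_ifs with h
  · simp only [LinearMap.comp_apply]
    obtain ⟨l, col, S⟩ := S
    obtain ⟨rfl, hS⟩ := h
    refine B.μ_mem S _ _ (DGMod.map_mem_tensorDeg m _ ?_ (j + a.thinShift - ∑ i, (col i).thinShift)
      _ ?_ _ (C.desuspend_mem S _ _ (C.Δ_mem a _ _ hx' ⟨l, col, S⟩)))
    · intro i r y hy
      exact hf i _ _ _ (DGMod.diag_mem _ _ hy)
    · rw [hS.sum_thinShift]; ring
  · simp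

theorem isLinearMap_sPTerm (n : ℕ) (m : Fin n → ℤ) (f : Fin n → Conv C B) (i : Fin n) (a : Arity)
    (S : StackingsTo a) [Decidable (S.1 + 1 = n ∧ S.2.2.ThinQuadratic)] :
    IsLinearMap k fun z : Conv C B => sPTerm n m (Function.update f i z) a S := by
  unfold sPTerm
  split_ifs with h
  · obtain ⟨l, col, S⟩ := S
    obtain ⟨rfl, hS⟩ := h
    let dg : ∀ i', C.thinDesusp (col i') →ₗ[k] C.thinDesusp (col i') := fun i' =>
      (C.thinDesusp (col i')).diag fun r => sg k ((∑ i ∈ Finset.univ.filter (i' < ·), m i) * r)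
    have key : ∀ z : Conv C B,
        DGMod.tensorMap (fun i => C.thinDesusp (col i)) (W := fun i => B.M (col i))
          (fun i => m (Fin.cast rfl i)) (fun i' => Function.update f i z (Fin.cast rfl i') (col i')) =
        PiTensorProduct.map (Function.update (fun i' => f i' (col i') ∘ₗ dg i') i
          (z (col i) ∘ₗ dg i)) := by
      intro z
      unfold DGMod.tensorMap
      congr 1
      funext i'
      by_cases hi : i' = i
      · subst hi; simp [dg]
      · simp [Function.update_of_ne hi, dg]
    simp only [key]
    constructor
    · intro x y
      rw [Pi.add_apply, LinearMap.add_comp, PiTensorProduct.map_update_add, LinearMap.add_comp,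
        LinearMap.comp_add]
    · intro r x
      rw [Pi.smul_apply, LinearMap.smul_comp, PiTensorProduct.map_update_smul, LinearMap.smul_comp,
        LinearMap.comp_smul]
  · exact ⟨fun x y => by simp, fun r x => by simp⟩

theorem isLinearMap_sP (n : ℕ) (m : Fin n → ℤ) (f : Fin n → Conv C B) (i : Fin n) :
    IsLinearMap k fun z : Conv C B => sP n m (Function.update f i z) := by
  classical
  constructor
  · intro x y
    funext a
    have h : (DirectSum.toModule k (StackingsTo a) (B.M a)
        fun S => sPTerm n m (Function.update f i (x + y)) a S) =
        (DirectSum.toModule k (StackingsTo a) (B.M a)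
          fun S => sPTerm n m (Function.update f i x) a S) +
        (DirectSum.toModule k (StackingsTo a) (B.M a)
          fun S => sPTerm n m (Function.update f i y) a S) := by
      refine DirectSum.linearMap_ext _ fun S => LinearMap.ext fun t => ?_
      simp only [LinearMap.comp_apply, LinearMap.add_apply, DirectSum.toModule_lof]
      exact LinearMap.congr_fun ((isLinearMap_sPTerm n m f i a S).map_add x y) t
    rw [Pi.add_apply]
    unfold sP
    rw [h, LinearMap.add_comp, smul_add]
  · intro r x
    funext a
    have h : (DirectSum.toModule k (StackingsTo a) (B.M a)
        fun S => sPTerm n m (Function.update f i (r • x)) a S) =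
        r • (DirectSum.toModule k (StackingsTo a) (B.M a)
          fun S => sPTerm n m (Function.update f i x) a S) := by
      refine DirectSum.linearMap_ext _ fun S => LinearMap.ext fun t => ?_
      simp only [LinearMap.comp_apply, LinearMap.smul_apply, DirectSum.toModule_lof]
      exact LinearMap.congr_fun ((isLinearMap_sPTerm n m f i a S).map_smul r x) t
    rw [Pi.smul_apply]
    unfold sP
    rw [h, LinearMap.smul_comp, smul_comm r]

/-- The operation `sP_n` as a multilinear map. -/
def sPMultilinear (C : ConilCooperad.{u, v} k) (B : BoxOperad.{u, w} k) (n : ℕ) (m : Fin n → ℤ) :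
    MultilinearMap k (fun _ : Fin n => Conv C B) (Conv C B) where
  toFun := sP n m
  map_update_add' := by
    intro hdec f i x y
    rw [Subsingleton.elim hdec (instDecidableEqFin n)]
    exact (isLinearMap_sP n m f i).map_add x y
  map_update_smul' := by
    intro hdec f i r x
    rw [Subsingleton.elim hdec (instDecidableEqFin n)]
    exact (isLinearMap_sP n m f i).map_smul r x

/-- The operation `sL_n` as a multilinear map. -/
def sLMultilinear (C : ConilCooperad.{u, v} k) (B : BoxOperad.{u, w} k) (n : ℕ) (m : Fin n → ℤ) :
    MultilinearMap k (fun _ : Fin n => Conv C B) (Conv C B) :=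
  ∑ σ : Equiv.Perm (Fin n),
    permSign k m σ • (sPMultilinear C B n fun i => m (σ i)).domDomCongr σ

theorem sLMultilinear_apply (n : ℕ) (m : Fin n → ℤ) (f : Fin n → Conv C B) :
    sLMultilinear C B n m f = sL n m f := by
  simp only [sLMultilinear, sL, sum_apply, smul_apply]
  rfl

theorem sL_mem (n : ℕ) (m : Fin n → ℤ) (f : Fin n → Conv C B) (hf : ∀ i, f i ∈ homDeg C B (m i)) :
    sL n m f ∈ homDeg C B (∑ i, m i - 1) := by
  refine Submodule.sum_mem _ fun σ _ => Submodule.smul_mem _ _ ?_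
  rw [← Equiv.sum_comp σ m]
  exact sP_mem n _ _ fun i => hf (σ i)

theorem homD_mem (m : ℤ) (f : Conv C B) (hf : f ∈ homDeg C B m) :
    homD C B m f ∈ homDeg C B (m - 1) := by
  intro a n x hx
  refine Submodule.sub_mem _ ?_ (Submodule.smul_mem _ _ ?_)
  · have h := (B.M a).d_mem _ _ (hf a n x hx)
    rw [show n + (m - 1) = n + m - 1 by ring]
    exact h
  · have h := hf a _ _ ((C.thinDesusp a).d_mem n x hx)
    rw [show n + (m - 1) = n - 1 + m by ring]
    exact h

end Conv

/-- The data of a suspended `L∞`-algebra: a graded module `V` with a differential and, for `n ≥ 2`,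
multilinear operations `l n` of degree `-1`. -/
structure SuspLInfData (k : Type u) [Field k] : Type (max u (w + 1)) where
  V : ℤ → Type w
  [addCommGroup : ∀ m, AddCommGroup (V m)]
  [module : ∀ m, Module k (V m)]
  d : ∀ m, V m →ₗ[k] V (m - 1)
  l : ∀ n : ℕ, 2 ≤ n → ∀ m : Fin n → ℤ, MultilinearMap k (fun i => V (m i)) (V (∑ i, m i - 1))

attribute [instance] SuspLInfData.addCommGroup SuspLInfData.module

/-- A strict morphism: a linear map of degree `0` which commutes with the differentials and
with all operations. -/
structure SuspLInfData.StrictHom (X : SuspLInfData.{u, v} k) (Y : SuspLInfData.{u, w} k) :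
    Type (max v w) where
  φ : ∀ m, X.V m →ₗ[k] Y.V m
  φ_d : ∀ (m : ℤ) (x : X.V m), φ (m - 1) (X.d m x) = Y.d m (φ m x)
  φ_l : ∀ (n : ℕ) (hn : 2 ≤ n) (m : Fin n → ℤ) (x : ∀ i, X.V (m i)),
    φ (∑ i, m i - 1) (X.l n hn m x) = Y.l n hn m fun i => φ (m i) (x i)

namespace Conv

/-- The suspended `L∞`-structure on the product over all arities of the modules of homogeneous maps
from the thin desuspension of `C` to `B`: the differential is `homD` and the operations are
the `sL_n`, `n ≥ 2`. -/
def suspLInf (C : ConilCooperad.{u, v} k) (B : BoxOperad.{u, w} k) :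
    SuspLInfData.{u, max u v w} k where
  V m := homDeg C B m
  d m := (homD C B m).restrict (homD_mem m)
  l n _ m := ((sLMultilinear C B n m).compLinearMap fun i => (homDeg C B (m i)).subtype).codRestrict
    (homDeg C B (∑ i, m i - 1)) fun f => by
      rw [MultilinearMap.compLinearMap_apply, sLMultilinear_apply]
      exact sL_mem n m _ fun i => (f i).2

/-- A twisting morphism from `C` to `B`: a family of maps of degree `0` which vanishes on the
coaugmentation and satisfies the Maurer-Cartan equation
`d α + ∑_{n ≥ 2} sP_n (α, …, α) = 0`. (Evaluated at an element, the sum is finite.) -/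
structure IsTwisting {C : ConilCooperad.{u, v} k} {B : BoxOperad.{u, w} k} (α : Conv C B) :
    Prop where
  degree : α ∈ homDeg C B 0
  coaug : ∀ a, α a ∘ₗ C.coaug a = 0
  maurerCartan : ∀ a x, homD C B 0 α a x +
    ∑ᶠ (n : ℕ) (_ : 2 ≤ n), sP n (fun _ => 0) (fun _ => α) a x = 0

end Conv

/-- The set of twisting morphisms from `C` to `B`. -/
def Tw (C : ConilCooperad.{u, v} k) (B : BoxOperad.{u, w} k) : Type (max u v w) :=
  {α : Conv C B // Conv.IsTwisting α}

end Convolution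

end

end BoxOp

-- Both parts are naturality statements for `sP`. At one stacking S, the operation is the chain:
-- project to the coaugmentation coideal, decompose by Δ_S, desuspend with signs, apply f_1 ⊗ ⋯ ⊗
-- f_n with Koszul signs, compose by μ_S. A morphism of box operads commutes with μ_S and a morphism
-- of cooperads commutes with Δ_S, so each can be moved to the end of the chain that it touches. No
-- relation between different stackings enters: not coassociativity, not the L∞ relations, not the
-- classification of thin-quadratic stackings.
--
-- The signs are the only point to check. Each is either a scalar depending on the degrees of the
-- f_i and the shape of S, or a degreewise scaling `diag` on the cooperad side. Morphisms have
-- degree 0, hence preserve the degrees of the f_i and commute with `diag` (`comp_diag`). The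
-- resulting lemmas are `sP_postcomp` and `sP_precomp`; summing the former over permutations gives
-- `sL_postcomp`, which with `homD_postcomp` is the strict morphism.
--
-- For twisting morphisms the Maurer-Cartan equation is transported term by term. Precomposition
-- evaluates the old equation at another element. Postcomposition applies a linear map to the
-- infinite sum, which is legitimate by `finite_support_sP`.

namespace BoxOp

noncomputable section

-- Maps of degree 0 and Koszul signs

namespace DGMod

variable {k : Type u} [Field k]

/-- The locus where two linear maps agree is a submodule, and the homogeneous parts have supremum ⊤.
This turns `diag_of_mem`, which speaks of homogeneous elements only, into identities of operators.
-/
theorem linearMap_ext_of_mem {V : DGMod.{u, v} k} {X : Type w} [AddCommGroup X] [Module k X]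
    {f g : V →ₗ[k] X} (h : ∀ n, ∀ x ∈ V.deg n, f x = g x) : f = g := by
  have htop := V.internal.submodule_iSup_eq_top
  refine LinearMap.ext fun x => ?_
  have hx : x ∈ ⨆ n, V.deg n := htop ▸ Submodule.mem_top
  have hle : (⨆ n, V.deg n) ≤ LinearMap.eqLocus f g := iSup_le fun n y hy => h n y hy
  exact hle hx

/-- Maps of degree `0` commute with the degreewise scaling operators. -/
theorem comp_diag {V : DGMod.{u, v} k} {W : DGMod.{u, w} k} (f : V →ₗ[k] W)
    (hf : ∀ n x, x ∈ V.deg n → f x ∈ W.deg n) (s : ℤ → k) :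
    f ∘ₗ V.diag s = W.diag s ∘ₗ f :=
  linearMap_ext_of_mem fun n x hx => by
    rw [LinearMap.comp_apply, LinearMap.comp_apply, V.diag_of_mem s hx,
      W.diag_of_mem s (hf n x hx), map_smul]

/-- The sign operators of `tensorMap` act on the source, so maps applied afterwards do not meet
them. The degrees `g` stay the same on both sides, which is the correct convention when the `f' i`
have degree 0. -/
theorem map_comp_tensorMap {n : ℕ} (V : Fin n → DGMod.{u, v} k) {W : Fin n → DGMod.{u, w} k}
    {W' : Fin n → DGMod.{u, w} k} (g : Fin n → ℤ) (f : ∀ i, V i →ₗ[k] W i)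
    (f' : ∀ i, W i →ₗ[k] W' i) :
    tensorMap V g (fun i => f' i ∘ₗ f i) = PiTensorProduct.map f' ∘ₗ tensorMap V g f := by
  unfold tensorMap
  rw [← PiTensorProduct.map_comp]
  rfl

/-- Here the maps `h i` must cross the sign operators, which is where degree 0 is needed. -/
theorem tensorMap_comp_map {n : ℕ} {V V' : Fin n → DGMod.{u, v} k} {W : Fin n → DGMod.{u, w} k}
    (g : Fin n → ℤ) (f : ∀ i, V' i →ₗ[k] W i) (h : ∀ i, V i →ₗ[k] V' i)
    (hh : ∀ i n x, x ∈ (V i).deg n → h i x ∈ (V' i).deg n) :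
    tensorMap V g (fun i => f i ∘ₗ h i) = tensorMap V' g f ∘ₗ PiTensorProduct.map h := by
  unfold tensorMap
  rw [← PiTensorProduct.map_comp]
  congr 1
  funext i
  rw [LinearMap.comp_assoc, LinearMap.comp_assoc, comp_diag (h i) (hh i)]

end DGMod

-- Naturality of the thin desuspended decomposition

namespace ConilCooperad

variable {k : Type u} [Field k] {C C' : ConilCooperad.{u, v} k}

theorem mapThinDesusp_mem (g : C ⟶ C') (a : Arity) (n : ℤ) (x : C.thinDesusp a)
    (hx : x ∈ (C.thinDesusp a).deg n) : mapThinDesusp g a x ∈ (C'.thinDesusp a).deg n :=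
  ⟨Hom.f_mem g a _ _ hx.1, hx.2⟩

/-- Desuspension rescales the differential by a sign determined by the colour alone, hence the same
for both cooperads; on the summand k the differential is zero. -/
theorem mapThinDesusp_comp_d (g : C ⟶ C') (a : Arity) :
    mapThinDesusp g a ∘ₗ (C.thinDesusp a).d = (C'.thinDesusp a).d ∘ₗ mapThinDesusp g a := by
  refine LinearMap.ext fun x => Prod.ext ?_ rfl
  change Hom.f g a (sg k a.thinShift • (C.M a).d x.1) =
    sg k a.thinShift • (C'.M a).d (Hom.f g a x.1)
  rw [map_smul, Hom.f_d]

/-- The thin desuspended infinitesimal decomposition is natural. -/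
theorem desuspend_comp_map (g : C ⟶ C') {n : ℕ} {col : Fin n → Arity} {out : Arity}
    (S : Stacking col out) :
    C'.desuspend S ∘ₗ PiTensorProduct.map (fun i => Hom.f g (col i)) =
      PiTensorProduct.map (fun i => mapThinDesusp g (col i)) ∘ₗ C.desuspend S := by
  have hincl : ∀ a, C'.incl a ∘ₗ Hom.f g a = mapThinDesusp g a ∘ₗ C.incl a := fun a =>
    LinearMap.ext fun x => Prod.ext rfl rfl
  -- Types I and II carry (-1)^|c₀| and differ only by a global sign, so one identity serves both.
  have key : PiTensorProduct.map (fun i => C'.incl (col i) ∘ₗ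
        if i.val = 0 then (C'.M (col i)).diag (sg k) else LinearMap.id) ∘ₗ
          PiTensorProduct.map (fun i => Hom.f g (col i)) =
      PiTensorProduct.map (fun i => mapThinDesusp g (col i)) ∘ₗ
        PiTensorProduct.map (fun i => C.incl (col i) ∘ₗ
          if i.val = 0 then (C.M (col i)).diag (sg k) else LinearMap.id) := by
    rw [← PiTensorProduct.map_comp, ← PiTensorProduct.map_comp]
    congr 1
    funext i
    rw [← LinearMap.comp_assoc, ← hincl, LinearMap.comp_assoc, LinearMap.comp_assoc]
    congr 1
    split_ifs
    · exact (DGMod.comp_diag _ (Hom.f_mem g _) _).symm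
    · rfl
  have key' : PiTensorProduct.map (fun i => C'.incl (col i)) ∘ₗ
        PiTensorProduct.map (fun i => Hom.f g (col i)) =
      PiTensorProduct.map (fun i => mapThinDesusp g (col i)) ∘ₗ
        PiTensorProduct.map (fun i => C.incl (col i)) := by
    rw [← PiTensorProduct.map_comp, ← PiTensorProduct.map_comp]
    simp only [hincl]
  unfold desuspend
  -- The type depends on the stacking only, so both cooperads are in the same case.
  split_ifs
  · exact key
  · rw [LinearMap.neg_comp, LinearMap.comp_neg, key]
  · rw [LinearMap.neg_comp, LinearMap.comp_neg, key']

/-- The comultiplication commutes with morphisms. -/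
theorem Δ_map (g : C ⟶ C') (a : Arity) (x : C.M a) :
    C'.Δ a (Hom.f g a x) =
      DirectSum.lmap (fun S : StackingsTo a => PiTensorProduct.map fun i => Hom.f g (S.2.1 i))
        (C.Δ a x) := by
  refine DFinsupp.ext fun S => ?_
  rw [Hom.f_Δ, DirectSum.lmap_apply]

end ConilCooperad

-- Naturality of the differential and of the operations

namespace Conv

variable {k : Type u} [Field k] {C C' : ConilCooperad.{u, v} k} {B B' : BoxOperad.{u, w} k}

theorem postcomp_mem (f : B ⟶ B') (m : ℤ) {h : Conv C B} (hh : h ∈ homDeg C B m) :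
    postcomp f h ∈ homDeg C B' m :=
  fun a n x hx => BoxOperad.Hom.f_mem f a _ _ (hh a n x hx)

theorem precomp_mem (g : C' ⟶ C) (m : ℤ) {h : Conv C B} (hh : h ∈ homDeg C B m) :
    precomp g h ∈ homDeg C' B m :=
  fun a n x hx => hh a n _ (ConilCooperad.mapThinDesusp_mem g a n x hx)

theorem homD_postcomp (f : B ⟶ B') (m : ℤ) (h : Conv C B) :
    homD C B' m (postcomp f h) = postcomp f (homD C B m h) := by
  funext a
  refine LinearMap.ext fun x => ?_
  change (B'.M a).d (BoxOperad.Hom.f f a (h a x)) -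
      sg k m • BoxOperad.Hom.f f a (h a ((C.thinDesusp a).d x)) =
    BoxOperad.Hom.f f a ((B.M a).d (h a x) - sg k m • h a ((C.thinDesusp a).d x))
  rw [map_sub, map_smul, BoxOperad.Hom.f_d]

theorem homD_precomp (g : C' ⟶ C) (m : ℤ) (h : Conv C B) :
    homD C' B m (precomp g h) = precomp g (homD C B m h) := by
  funext a
  refine LinearMap.ext fun x => ?_
  change (B.M a).d (h a (ConilCooperad.mapThinDesusp g a x)) -
      sg k m • h a (ConilCooperad.mapThinDesusp g a ((C'.thinDesusp a).d x)) =
    (B.M a).d (h a (ConilCooperad.mapThinDesusp g a x)) -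
      sg k m • h a ((C.thinDesusp a).d (ConilCooperad.mapThinDesusp g a x))
  rw [← LinearMap.comp_apply (ConilCooperad.mapThinDesusp g a),
    ConilCooperad.mapThinDesusp_comp_d]
  rfl

open scoped Classical in
-- Compatibility of `f` with μ_S moves it inside, onto the tensor factors. Whether the summand is
-- zero by definition depends on S and n only.
theorem sPTerm_postcomp (f : B ⟶ B') (n : ℕ) (m : Fin n → ℤ) (h : Fin n → Conv C B) (a : Arity)
    (S : StackingsTo a) :
    sPTerm n m (fun i => postcomp f (h i)) a S =
      BoxOperad.Hom.f f a ∘ₗ sPTerm n m h a S := by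
  unfold sPTerm
  split_ifs with hS
  · refine LinearMap.ext fun t => ?_
    simp only [LinearMap.comp_apply, BoxOperad.Hom.f_μ]
    congr 1
    exact LinearMap.congr_fun (DGMod.map_comp_tensorMap (fun i => C.thinDesusp (S.2.1 i))
      (fun i => m (Fin.cast hS.1 i)) (fun i => h (Fin.cast hS.1 i) (S.2.1 i))
      (fun i => BoxOperad.Hom.f f (S.2.1 i))) _
  · rw [LinearMap.comp_zero]

open scoped Classical in
theorem sPTerm_precomp (g : C' ⟶ C) (n : ℕ) (m : Fin n → ℤ) (h : Fin n → Conv C B) (a : Arity)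
    (S : StackingsTo a) :
    sPTerm n m (fun i => precomp g (h i)) a S =
      sPTerm n m h a S ∘ₗ
        PiTensorProduct.map fun i => ConilCooperad.Hom.f g (S.2.1 i) := by
  unfold sPTerm
  split_ifs with hS
  · have htensor := DGMod.tensorMap_comp_map (fun i => m (Fin.cast hS.1 i))
      (fun i => h (Fin.cast hS.1 i) (S.2.1 i)) (fun i => ConilCooperad.mapThinDesusp g (S.2.1 i))
      fun i => ConilCooperad.mapThinDesusp_mem g (S.2.1 i)
    refine LinearMap.ext fun t => congrArg (B.μ S.2.2) ?_
    have hdesusp := LinearMap.congr_fun (ConilCooperad.desuspend_comp_map g S.2.2) t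
    simp only [LinearMap.comp_apply] at hdesusp ⊢
    -- Both sides now start from the desuspended tensor in `C'`; only the passage of `g` through the
    -- Koszul signs is left.
    rw [hdesusp]
    exact LinearMap.congr_fun htensor _
  · rw [LinearMap.zero_comp]

open scoped Classical in
theorem sP_postcomp (f : B ⟶ B') (n : ℕ) (m : Fin n → ℤ) (h : Fin n → Conv C B) :
    sP n m (fun i => postcomp f (h i)) = postcomp f (sP n m h) := by
  funext a
  have hsum : DirectSum.toModule k (StackingsTo a) (B'.M a)
        (fun S => sPTerm n m (fun i => postcomp f (h i)) a S) =
      BoxOperad.Hom.f f a ∘ₗ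
        DirectSum.toModule k (StackingsTo a) (B.M a) (fun S => sPTerm n m h a S) := by
    -- Linear maps out of the direct sum are compared one stacking at a time.
    refine DirectSum.linearMap_ext _ fun S => LinearMap.ext fun t => ?_
    simp only [LinearMap.comp_apply, DirectSum.toModule_lof]
    exact LinearMap.congr_fun (sPTerm_postcomp f n m h a S) t
  refine LinearMap.ext fun x => ?_
  refine Eq.trans ?_ (map_smul (BoxOperad.Hom.f f a) _ _).symm
  exact congrArg (sg k (∑ i, m i) • ·) (LinearMap.congr_fun hsum (C.Δ a (C.proj a x)))

open scoped Classical in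
theorem sP_precomp (g : C' ⟶ C) (n : ℕ) (m : Fin n → ℤ) (h : Fin n → Conv C B) :
    sP n m (fun i => precomp g (h i)) = precomp g (sP n m h) := by
  funext a
  have hsum : DirectSum.toModule k (StackingsTo a) (B.M a)
        (fun S => sPTerm n m (fun i => precomp g (h i)) a S) =
      DirectSum.toModule k (StackingsTo a) (B.M a) (fun S => sPTerm n m h a S) ∘ₗ
        DirectSum.lmap fun S : StackingsTo a =>
          PiTensorProduct.map fun i => ConilCooperad.Hom.f g (S.2.1 i) := by
    refine DirectSum.linearMap_ext _ fun S => LinearMap.ext fun t => ?_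
    simp only [LinearMap.comp_apply, DirectSum.toModule_lof, DirectSum.lmap_lof]
    exact LinearMap.congr_fun (sPTerm_precomp g n m h a S) t
  refine LinearMap.ext fun x => ?_
  refine congrArg (fun y : B.M a => sg k (∑ i, m i) • y) ?_
  refine (LinearMap.congr_fun hsum (C'.Δ a (C'.proj a x))).trans ?_
  -- The map induced by `g` on the thin desuspension commutes with the projection to the coideal by
  -- definition, so `Δ_map` applies to the projected element.
  exact congrArg (DirectSum.toModule k (StackingsTo a) (B.M a) fun S => sPTerm n m h a S)
    (ConilCooperad.Δ_map g a (C'.proj a x)).symm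

/-- Post-composition with a morphism of dg box operads as a linear map. -/
def postcompLinear (C : ConilCooperad.{u, v} k) (f : B ⟶ B') : Conv C B →ₗ[k] Conv C B' where
  toFun := postcomp f
  map_add' _ _ := funext fun _ => LinearMap.comp_add _ _ _
  map_smul' _ _ := funext fun _ => LinearMap.comp_smul _ _ _

/-- The permutation signs are computed from the degrees `m`, which postcomposition does not change,
so the symmetrised sums agree term by term. -/
theorem sL_postcomp (f : B ⟶ B') (n : ℕ) (m : Fin n → ℤ) (h : Fin n → Conv C B) :
    sL n m (fun i => postcomp f (h i)) = postcomp f (sL n m h) := by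
  change _ = postcompLinear C f (sL n m h)
  unfold sL
  rw [map_sum]
  refine Finset.sum_congr rfl fun σ _ => ?_
  rw [map_smul, sP_postcomp f n (fun i => m (σ i)) fun i => h (σ i)]
  rfl

-- Twisting morphisms

/-- On every element only finitely many of the operations `sP_n` are non-zero. -/
theorem finite_support_sP (α : Conv C B) (a : Arity) (x : C.thinDesusp a) :
    {n : ℕ | sP n (fun _ => 0) (fun _ => α) a x ≠ 0}.Finite := by
  classical
  -- The decomposition of an element lies in a direct sum, so it involves finitely many stackings,
  -- and `sP n` sees only those with n boxes. A stacking with index `S.1` has `S.1 + 1` boxes.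
  refine ((DFinsupp.support (C.Δ a (C.proj a x))).image fun S => S.1 + 1).finite_toSet.subset
    fun n hn => ?_
  by_contra hmem
  refine hn ?_
  unfold sP
  rw [LinearMap.smul_apply, LinearMap.comp_apply, LinearMap.comp_apply]
  convert smul_zero _
  rw [← DirectSum.sum_support_of (C.Δ a (C.proj a x)), map_sum]
  refine Finset.sum_eq_zero fun S hS => ?_
  refine (DirectSum.toModule_lof k S _).trans ?_
  have hne : S.1 + 1 ≠ n := fun h => hmem (Finset.mem_coe.2 (Finset.mem_image.2 ⟨S, hS, h⟩))
  rw [sPTerm, dif_neg fun h => hne h.1, LinearMap.zero_apply]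

theorem IsTwisting.postcomp (f : B ⟶ B') {α : Conv C B} (hα : IsTwisting α) :
    IsTwisting (Conv.postcomp f α) where
  degree := postcomp_mem f 0 hα.degree
  coaug a := by
    unfold Conv.postcomp
    rw [LinearMap.comp_assoc, hα.coaug, LinearMap.comp_zero]
  maurerCartan a x := by
    have hsum : BoxOperad.Hom.f f a
          (∑ᶠ (n : ℕ) (_ : 2 ≤ n), sP n (fun _ => 0) (fun _ => α) a x) =
        ∑ᶠ (n : ℕ) (_ : 2 ≤ n), sP n (fun _ => 0) (fun _ => Conv.postcomp f α) a x := by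
      -- Finiteness is essential: a `finsum` with infinite support is 0 by default, and a linear map
      -- may kill enough terms to make the support finite.
      refine ((BoxOperad.Hom.f f a).toAddMonoidHom.map_finsum_mem' ?_).trans ?_
      · exact (finite_support_sP α a x).subset Set.inter_subset_right
      · refine finsum_congr fun n => finsum_congr fun _ => ?_
        rw [sP_postcomp f n (fun _ => 0) fun _ => α]
        rfl
    rw [homD_postcomp, ← hsum]
    change BoxOperad.Hom.f f a _ + _ = 0
    rw [← map_add, hα.maurerCartan, map_zero]

theorem IsTwisting.precomp (g : C' ⟶ C) {α : Conv C B} (hα : IsTwisting α) :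
    IsTwisting (Conv.precomp g α) where
  degree := precomp_mem g 0 hα.degree
  coaug a := by
    -- Morphisms are extended by the identity on k, so they carry the coaugmentation to the
    -- coaugmentation.
    have h : ConilCooperad.mapThinDesusp g a ∘ₗ C'.coaug a = C.coaug a :=
      LinearMap.ext fun y => Prod.ext (map_zero (ConilCooperad.Hom.f g a)) rfl
    unfold Conv.precomp
    rw [LinearMap.comp_assoc, h, hα.coaug]
  maurerCartan a x := by
    rw [homD_precomp]
    simp only [sP_precomp g _ (fun _ => 0) fun _ => α]
    -- The sum is literally the one for `α` at the image of `x`, so no finiteness argument is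
    -- needed.
    exact hα.maurerCartan a (ConilCooperad.mapThinDesusp g a x)

end Conv

-- The functor and the strict morphism

variable {k : Type u} [Field k]

/-- The functor of twisting morphisms. -/
def twFunctor (k : Type u) [Field k] :
    (ConilCooperad.{u, v} k)ᵒᵖ × BoxOperad.{u, w} k ⥤ Type (max u v w) where
  obj X := Tw X.1.unop X.2
  map φ := TypeCat.ofHom fun α => ⟨_, (α.2.precomp φ.1.unop).postcomp φ.2⟩
  -- Composition of linear maps is unital and associative on the nose, so both functor laws hold by
  -- definition.
  map_id _ := by
    ext α
    rfl
  map_comp _ _ := by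
    ext α
    rfl

/-- Post-composition with a morphism of dg box operads is a strict morphism of suspended
`L∞`-algebras. -/
def postcompStrictHom (C : ConilCooperad.{u, v} k) {B B' : BoxOperad.{u, w} k} (f : B ⟶ B') :
    SuspLInfData.StrictHom (Conv.suspLInf C B) (Conv.suspLInf C B') where
  φ m := (Conv.postcompLinear C f).restrict fun _ hh => Conv.postcomp_mem f m hh
  φ_d m x := Subtype.ext (Conv.homD_postcomp f m x.1).symm
  φ_l n hn m x := by
    -- The homogeneous parts are submodules of `Conv`, so the identity may be checked there, where
    -- no degrees occur in the types.
    refine Subtype.ext ?_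
    change Conv.postcomp f (Conv.sLMultilinear C B n m fun i => (x i).1) =
      Conv.sLMultilinear C B' n m fun i => Conv.postcomp f (x i).1
    rw [Conv.sLMultilinear_apply, Conv.sLMultilinear_apply, Conv.sL_postcomp]

end

end BoxOp

theorem mainTheorem10 (k : Type u) [Field k] :
    (∃ (F : (BoxOp.ConilCooperad.{u, v} k)ᵒᵖ × BoxOp.BoxOperad.{u, w} k ⥤ Type (max u v w))
        (hF : ∀ (C : BoxOp.ConilCooperad.{u, v} k) (B : BoxOp.BoxOperad.{u, w} k),
          F.obj (Opposite.op C, B) = BoxOp.Tw C B),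
      ∀ (C C' : BoxOp.ConilCooperad.{u, v} k) (B B' : BoxOp.BoxOperad.{u, w} k)
        (g : C' ⟶ C) (f : B ⟶ B') (α : F.obj (Opposite.op C, B)),
        (cast (hF C' B') (F.map (Prod.mkHom g.op f) α)).1 =
          BoxOp.Conv.postcomp f (BoxOp.Conv.precomp g (cast (hF C B) α).1)) ∧
    (∀ (C : BoxOp.ConilCooperad.{u, v} k) (B B' : BoxOp.BoxOperad.{u, w} k) (f : B ⟶ B'),
      ∃ Φ : BoxOp.SuspLInfData.StrictHom
          (BoxOp.Conv.suspLInf C B) (BoxOp.Conv.suspLInf C B'),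
        ∀ (m : ℤ) (h : BoxOp.Conv.homDeg C B m),
          (Φ.φ m h : BoxOp.Conv.homDeg C B' m).1 = BoxOp.Conv.postcomp f h.1) := by
  -- The values on objects agree by definition, so the casts are identities.
  exact ⟨⟨BoxOp.twFunctor k, fun _ _ => rfl, fun _ _ _ _ _ _ _ => rfl⟩,
    fun C _ _ f => ⟨BoxOp.postcompStrictHom C f, fun _ _ => rfl⟩⟩
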